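/- Let $n \ge 1$ and let $W, B \in \mathbb{R}^{n \times n}$. Assume that $W$ is row-stochastic (its entries are nonnegative and each row sums to $1$) and primitive (there is $m \ge 1$ such that all entries of $W^m$ are strictly positive), and that $B$ is nonzero with nonnegative entries. For real $t$ put $$P(t) = W(I - tB), \qquad R(t) = I - W + (I + tB)^{-1}(2W - I),$$ the latter whenever $I + tB$ is invertible. For a square matrix $M$ let $\varrho(M) = \max\{|\lambda| : \lambda \in \mathbb{C} \text{ an eigenvalue of } M\}$; $M$ is called Schur stable if $\varrho(M) < 1$. Then there exists $T > 0$ such that for all $0 < t < T$ the matrix $I + tB$ is invertible and both $P(t)$ and $R(t)$ are Schur stable. -/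

import Mathlib

noncomputable section

namespace ImageOperators

/-- A complex square matrix is Schur stable if its spectral radius, the largest modulus of an
eigenvalue, is less than `1`. -/
def SchurStable {n : ℕ} (M : Matrix (Fin n) (Fin n) ℂ) : Prop :=
  spectralRadius ℂ M < 1

/-- A real square matrix viewed as a complex one. -/
def complexify {n : ℕ} (M : Matrix (Fin n) (Fin n) ℝ) : Matrix (Fin n) (Fin n) ℂ :=
  M.map (fun x : ℝ => (x : ℂ))

/-- The operator `P(t) = W (I - t B)`. -/
def P {n : ℕ} (W B : Matrix (Fin n) (Fin n) ℝ) (t : ℝ) : Matrix (Fin n) (Fin n) ℝ :=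
  W * (1 - t • B)

/-- The operator `R(t) = I - W + (I + t B)⁻¹ (2 W - I)`, meaningful when `I + t B` is
invertible. -/
def R {n : ℕ} (W B : Matrix (Fin n) (Fin n) ℝ) (t : ℝ) : Matrix (Fin n) (Fin n) ℝ :=
  1 - W + (1 + t • B)⁻¹ * ((2 : ℝ) • W - 1)

end ImageOperators

end

open Matrix Filter Topology Finset

namespace ImageOperators

variable {n : ℕ}

/-! Both operators have the form `W + t A(t)` with `A(t) → A₀`, where `A₀` is `-WB` for `P` and
`-B(2W - I)` for `R`. If `p > 0` is the left Perron vector, then `pW = p` and `W1 = 1` give `p A₀ 1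
= -p B 1 < 0` in both cases, so the Perron eigenvalue `1` moves inwards. `eventually_schurStable`
makes this rigorous by compactness: eigenpairs violating stability accumulate, as `t → 0+`, at the
eigenvalue `1` and a constant vector, and pairing with `p` gives a slope of the wrong sign. -/

lemma complexify_eq_mapMatrix (M : Matrix (Fin n) (Fin n) ℝ) :
    complexify M = Complex.ofRealHom.mapMatrix M := rfl

lemma complexify_mulVec_apply (M : Matrix (Fin n) (Fin n) ℝ) (v : Fin n → ℂ) (i : Fin n) :
    (complexify M *ᵥ v) i = ∑ j, (M i j : ℂ) * v j := rfl

/-- A matrix is Schur stable as soon as it has no eigenvalue of modulus at least `1`; the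
reciprocal `μ` of such an eigenvalue is used to stay in the closed unit disc. -/
lemma schurStable_of_forall_ne (M : Matrix (Fin n) (Fin n) ℂ)
    (h : ∀ (μ : ℂ) (v : Fin n → ℂ), ‖μ‖ ≤ 1 → ‖v‖ = 1 → v ≠ μ • (M *ᵥ v)) :
    SchurStable M := by
  have key : ∀ k ∈ spectrum ℂ M, ‖k‖₊ < 1 := by
    intro k hk
    by_contra hlt
    have hk1 : 1 ≤ ‖k‖ := by simpa [← NNReal.coe_le_coe] using hlt
    have hk0 : k ≠ 0 := by
      rintro rfl
      norm_num at hk1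
    rw [← Matrix.spectrum_toLin', ← Module.End.hasEigenvalue_iff_mem_spectrum] at hk
    obtain ⟨v, hv⟩ := hk.exists_hasEigenvector
    have hMv : M *ᵥ v = k • v := by simpa using hv.apply_eq_smul
    have hnorm : ‖((‖v‖⁻¹ : ℝ) : ℂ) • v‖ = 1 := by
      rw [norm_smul, Complex.norm_real, norm_inv, norm_norm,
        inv_mul_cancel₀ (norm_ne_zero_iff.2 hv.2)]
    refine h k⁻¹ _ ?_ hnorm ?_
    · rw [norm_inv]
      exact inv_le_one_of_one_le₀ hk1
    · rw [mulVec_smul, hMv, smul_smul, smul_smul, mul_right_comm, inv_mul_cancel₀ hk0, one_mul]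
  have hfin : (spectrum ℂ M).Finite := Matrix.finite_spectrum M
  have hsup : spectralRadius ℂ M = hfin.toFinset.sup (fun k => (‖k‖₊ : ENNReal)) := by
    rw [Finset.sup_eq_iSup]
    simp [spectralRadius]
  rw [SchurStable, hsup, Finset.sup_lt_iff (by simp)]
  intro k hk
  exact_mod_cast key k (by simpa using hk)

/-! ### Perron theory of primitive stochastic matrices -/

lemma eq_pow_smul_of_eq_smul {M : Matrix (Fin n) (Fin n) ℂ} {μ : ℂ} {v : Fin n → ℂ}
    (h : v = μ • (M *ᵥ v)) (m : ℕ) : v = μ ^ m • ((M ^ m) *ᵥ v) := by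
  induction m with
  | zero => simp
  | succ m ih =>
    calc v = μ ^ m • ((M ^ m) *ᵥ v) := ih
      _ = μ ^ m • ((M ^ m) *ᵥ (μ • (M *ᵥ v))) := by rw [← h]
      _ = _ := by rw [mulVec_smul, mulVec_mulVec, ← pow_succ, smul_smul, ← pow_succ]

/-- The strict maximum principle for a stochastic matrix with positive entries. -/
lemma apply_eq_apply_of_pos {S : Matrix (Fin n) (Fin n) ℝ} (hS : S ∈ rowStochastic ℝ (Fin n))
    (hpos : ∀ i j, 0 < S i j) {ν : ℂ} (hν : ‖ν‖ ≤ 1) {v : Fin n → ℂ}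
    (h : v = ν • (complexify S *ᵥ v)) (j k : Fin n) : v j = v k := by
  obtain ⟨i, -, hi⟩ := Finset.exists_max_image univ (fun i => ‖v i‖) ⟨j, mem_univ j⟩
  have hi' : ∀ l, ‖ν * v l‖ ≤ ‖v i‖ := fun l => by
    rw [norm_mul]
    nlinarith [hi l (mem_univ l), norm_nonneg (v l)]
  have hvi : v i = ∑ l, (S i l : ℂ) * (ν * v l) := by
    conv_lhs => rw [h]
    simp only [Pi.smul_apply, complexify_mulVec_apply, smul_eq_mul, Finset.mul_sum]
    exact Finset.sum_congr rfl fun l _ => by ring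
  -- Equality case of Cauchy–Schwarz: the `r l` are at most `‖v i‖ ^ 2` and their average with
  -- positive weights equals it, so each one does.
  set r : Fin n → ℝ := fun l => inner ℝ (v i) (ν * v l) with hr
  have hrle : ∀ l, r l ≤ ‖v i‖ ^ 2 := fun l => by
    have := real_inner_le_norm (v i) (ν * v l)
    nlinarith [hi' l, norm_nonneg (v i)]
  have hsum : ∑ l, S i l * (‖v i‖ ^ 2 - r l) = 0 := by
    have h1 : ‖v i‖ ^ 2 = ∑ l, S i l * r l := by
      rw [← real_inner_self_eq_norm_sq]
      nth_rw 2 [hvi]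
      rw [inner_sum]
      refine Finset.sum_congr rfl fun l _ => ?_
      rw [hr, ← real_inner_smul_right, Complex.real_smul]
    simp only [mul_sub, Finset.sum_sub_distrib, ← Finset.sum_mul,
      sum_row_of_mem_rowStochastic hS, ← h1]
    ring
  have heq : ∀ l, ν * v l = v i := fun l => by
    have h0 := (Finset.sum_eq_zero_iff_of_nonneg fun l _ =>
      mul_nonneg (hpos i l).le (sub_nonneg.2 (hrle l))).1 hsum l (mem_univ l)
    have h2 : r l = ‖v i‖ ^ 2 := by
      rcases mul_eq_zero.1 h0 with h0 | h0
      · exact absurd h0 (hpos i l).ne'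
      · linarith
    have h3 := norm_sub_sq_real (v i) (ν * v l)
    have h4 : ‖v i - ν * v l‖ ^ 2 ≤ 0 := by
      rw [h3]
      change _ - 2 * r l + _ ≤ _
      rw [h2]
      nlinarith [hi' l, norm_nonneg (ν * v l)]
    have h5 : ‖v i - ν * v l‖ = 0 := by
      nlinarith [norm_nonneg (v i - ν * v l)]
    exact (sub_eq_zero.1 (norm_eq_zero.1 h5)).symm
  by_cases hν0 : ν = 0
  · rw [hν0, zero_smul] at h
    simp [h]
  · exact mul_left_cancel₀ hν0 ((heq j).trans (heq k).symm)

/-- Iterating the equation replaces `W` by a positive power, where the strict maximum principle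
applies. -/
lemma apply_eq_apply_of_isPrimitive {W : Matrix (Fin n) (Fin n) ℝ}
    (hWs : W ∈ rowStochastic ℝ (Fin n)) (hWp : W.IsPrimitive) {μ : ℂ} (hμ : ‖μ‖ ≤ 1)
    {v : Fin n → ℂ} (h : v = μ • (complexify W *ᵥ v)) (j k : Fin n) : v j = v k := by
  obtain ⟨m, -, hm⟩ := hWp.exists_pos_pow
  refine apply_eq_apply_of_pos (pow_mem hWs m) hm (ν := μ ^ m) ?_ ?_ j k
  · rw [norm_pow]
    exact pow_le_one₀ (norm_nonneg _) hμ
  · rw [complexify_eq_mapMatrix, map_pow, ← complexify_eq_mapMatrix]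
    exact eq_pow_smul_of_eq_smul h m

/-- The left Perron vector of a primitive stochastic matrix. -/
lemma exists_pos_vecMul_eq {W : Matrix (Fin n) (Fin n) ℝ} (hn : 0 < n)
    (hWs : W ∈ rowStochastic ℝ (Fin n)) (hWp : W.IsPrimitive) :
    ∃ p : Fin n → ℝ, (∀ i, 0 < p i) ∧ p ᵥ* W = p := by
  have : Nonempty (Fin n) := ⟨⟨0, hn⟩⟩
  obtain ⟨x, hx0, hx⟩ : ∃ x ≠ 0, x ᵥ* (W - 1) = 0 := by
    rw [exists_vecMul_eq_zero_iff, ← exists_mulVec_eq_zero_iff]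
    exact ⟨1, one_ne_zero, by simp [sub_mulVec, one_vecMul_of_mem_rowStochastic hWs]⟩
  have hxW : x ᵥ* W = x := by simpa [vecMul_sub, sub_eq_zero] using hx
  set p : Fin n → ℝ := fun i => |x i| with hp
  -- The triangle inequality gives `p ≤ pW`. Row sums `1` make the totals agree, which forces
  -- equality.
  have hle : ∀ j, p j ≤ (p ᵥ* W) j := fun j => by
    calc p j = |∑ i, x i * W i j| := congrArg abs (congrFun hxW j).symm
      _ ≤ ∑ i, |x i * W i j| := Finset.abs_sum_le_sum_abs _ _
      _ = ∑ i, p i * W i j := by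
        simp [abs_mul, hp, abs_of_nonneg (hWp.nonneg _ _)]
  have hsum : ∑ j, p j = ∑ j, (p ᵥ* W) j := by
    have : (p ᵥ* W) ⬝ᵥ 1 = p ⬝ᵥ 1 := by
      rw [← dotProduct_mulVec, one_vecMul_of_mem_rowStochastic hWs]
    simpa only [dotProduct_one] using this.symm
  have hpW : p ᵥ* W = p := funext fun j =>
    ((Finset.sum_eq_sum_iff_of_le fun j _ => hle j).1 hsum j (mem_univ j)).symm
  obtain ⟨m, -, hm⟩ := hWp.exists_pos_pow
  have hpow : ∀ k : ℕ, p ᵥ* W ^ k = p := fun k => by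
    induction k with
    | zero => simp
    | succ k ih => rw [pow_succ, ← vecMul_vecMul, ih, hpW]
  refine ⟨p, fun j => ?_, hpW⟩
  rw [← hpow m]
  obtain ⟨i, hi⟩ := Function.ne_iff.1 hx0
  change 0 < ∑ i, |x i| * (W ^ m) i j
  exact Finset.sum_pos' (fun i _ => mul_nonneg (abs_nonneg _) (hm i j).le)
    ⟨i, mem_univ i, mul_pos (abs_pos.2 hi) (hm i j)⟩

/-! ### Perturbation as `t → 0+` -/

lemma tendsto_dotProduct {α : Type*} {l : Filter α} (q : Fin n → ℂ) {w : α → Fin n → ℂ}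
    {w₀ : Fin n → ℂ} (hw : Tendsto w l (𝓝 w₀)) :
    Tendsto (fun t => q ⬝ᵥ w t) l (𝓝 (q ⬝ᵥ w₀)) :=
  tendsto_finsetSum _ fun i _ => (tendsto_pi_nhds.1 hw i).const_mul (q i)

lemma tendsto_complexify_mulVec {α : Type*} {l : Filter α} {M : α → Matrix (Fin n) (Fin n) ℝ}
    {M₀ : Matrix (Fin n) (Fin n) ℝ} {w : α → Fin n → ℂ} {w₀ : Fin n → ℂ}
    (hM : Tendsto M l (𝓝 M₀)) (hw : Tendsto w l (𝓝 w₀)) :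
    Tendsto (fun t => complexify (M t) *ᵥ w t) l (𝓝 (complexify M₀ *ᵥ w₀)) := by
  refine tendsto_pi_nhds.2 fun i => ?_
  simp only [complexify_mulVec_apply]
  refine tendsto_finsetSum _ fun j _ => ?_
  have hMij := tendsto_pi_nhds.1 (tendsto_pi_nhds.1 hM i) j
  exact ((Complex.continuous_ofReal.tendsto _).comp hMij).mul (tendsto_pi_nhds.1 hw j)

/-- First-order perturbation of a primitive stochastic matrix `W` along a direction that lowers
the Perron eigenvalue. -/
lemma eventually_schurStable {W : Matrix (Fin n) (Fin n) ℝ} (hWs : W ∈ rowStochastic ℝ (Fin n))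
    (hWp : W.IsPrimitive) {p : Fin n → ℝ} (hp : ∀ i, 0 < p i) (hpW : p ᵥ* W = p)
    {A : ℝ → Matrix (Fin n) (Fin n) ℝ} {A₀ : Matrix (Fin n) (Fin n) ℝ}
    (hA : Tendsto A (𝓝[>] 0) (𝓝 A₀)) (hneg : p ⬝ᵥ (A₀ *ᵥ 1) < 0) :
    ∀ᶠ t in 𝓝[>] (0 : ℝ), SchurStable (complexify (W + t • A t)) := by
  by_contra hcon
  rw [not_eventually] at hcon
  have hbad : ∃ᶠ t in 𝓝[>] (0 : ℝ), ∃ (μ : ℂ) (v : Fin n → ℂ),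
      ‖μ‖ ≤ 1 ∧ ‖v‖ = 1 ∧ v = μ • (complexify (W + t • A t) *ᵥ v) := by
    refine hcon.mono fun t ht => ?_
    by_contra hno
    exact ht (schurStable_of_forall_ne _ fun μ v hμ hv he => hno ⟨μ, v, hμ, hv, he⟩)
  -- Along an ultrafilter the bounded families `μ'` and `v'` converge, so no subsequences are
  -- needed.
  obtain ⟨l, hle⟩ := exists_ultrafilter_iff.2 (frequently_iff_neBot.1 hbad)
  have hl : (l : Filter ℝ) ≤ 𝓝[>] 0 := hle.trans inf_le_left
  have hlbad : ∀ᶠ t in (l : Filter ℝ), ∃ (μ : ℂ) (v : Fin n → ℂ),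
      ‖μ‖ ≤ 1 ∧ ‖v‖ = 1 ∧ v = μ • (complexify (W + t • A t) *ᵥ v) :=
    le_principal_iff.1 (hle.trans inf_le_right)
  obtain ⟨μ', hlbad⟩ := hlbad.choice
  obtain ⟨v', hlbad⟩ := hlbad.choice
  obtain ⟨μ, hμmem, hμ⟩ := (isCompact_closedBall (0 : ℂ) 1).ultrafilter_le_nhds (l.map μ')
    (le_principal_iff.2 (hlbad.mono fun t ht => by simpa using ht.1))
  obtain ⟨v, hvmem, hv⟩ := (isCompact_sphere (0 : Fin n → ℂ) 1).ultrafilter_le_nhds (l.map v')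
    (le_principal_iff.2 (hlbad.mono fun t ht => by simpa using ht.2.1))
  have hμ1 : ‖μ‖ ≤ 1 := by simpa using hμmem
  have hv1 : ‖v‖ = 1 := by simpa using hvmem
  replace hμ : Tendsto μ' l (𝓝 μ) := hμ
  replace hv : Tendsto v' l (𝓝 v) := hv
  have hAl : Tendsto A l (𝓝 A₀) := hA.mono_left hl
  have ht0 : Tendsto (fun t : ℝ => t) l (𝓝 0) :=
    (tendsto_id.mono_left nhdsWithin_le_nhds).mono_left hl
  have htpos : ∀ᶠ t in (l : Filter ℝ), 0 < t := hl self_mem_nhdsWithin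
  have hlim : v = μ • (complexify W *ᵥ v) := by
    have h1 : Tendsto (fun t => W + t • A t) l (𝓝 W) := by
      simpa using tendsto_const_nhds.add (ht0.smul hAl)
    refine tendsto_nhds_unique (hv.congr' ?_) (hμ.smul (tendsto_complexify_mulVec h1 hv))
    exact hlbad.mono fun t ht => ht.2.2
  have hconst := apply_eq_apply_of_isPrimitive hWs hWp hμ1 hlim
  have hv0 : v ≠ 0 := norm_ne_zero_iff.1 (by rw [hv1]; exact one_ne_zero)
  obtain ⟨i, hi⟩ := Function.ne_iff.1 hv0
  have hvi : v = v i • (1 : Fin n → ℂ) := funext fun j => by simp [hconst j i]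
  set q : Fin n → ℂ := fun i => (p i : ℂ) with hq
  have hqW : q ᵥ* complexify W = q := funext fun j => by
    have := congrFun hpW j
    simp only [vecMul, dotProduct] at this
    simp only [vecMul, dotProduct, hq, complexify, map_apply]
    exact_mod_cast this
  have hq1 : q ⬝ᵥ 1 = ((p ⬝ᵥ 1 : ℝ) : ℂ) := by simp [hq, dotProduct]
  have hqA : q ⬝ᵥ (complexify A₀ *ᵥ 1) = ((p ⬝ᵥ (A₀ *ᵥ 1) : ℝ) : ℂ) := by
    simp [hq, dotProduct, mulVec, complexify]
  have hp1 : 0 < p ⬝ᵥ 1 := by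
    simpa [dotProduct] using Finset.sum_pos (fun i _ => hp i) ⟨i, mem_univ i⟩
  have hqv : q ⬝ᵥ v = v i * ((p ⬝ᵥ 1 : ℝ) : ℂ) := by
    rw [← hq1]
    conv_lhs => rw [hvi]
    rw [dotProduct_smul, smul_eq_mul]
  have hqv0 : q ⬝ᵥ v ≠ 0 := by
    rw [hqv]
    exact mul_ne_zero hi (by exact_mod_cast hp1.ne')
  have hdot : Tendsto (fun t => q ⬝ᵥ v' t) l (𝓝 (q ⬝ᵥ v)) := tendsto_dotProduct q hv
  have hμone : μ = 1 := by
    have h1 : q ⬝ᵥ v = μ * (q ⬝ᵥ v) := by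
      conv_lhs => rw [hlim]
      rw [dotProduct_smul, dotProduct_mulVec, hqW, smul_eq_mul]
    exact mul_right_cancel₀ hqv0 (by rw [one_mul, ← h1])
  -- Pairing with the left fixed vector `q` eliminates `W` and gives an exact difference quotient,
  -- without differentiating eigenvalues.
  have hid : ∀ᶠ t in (l : Filter ℝ), (μ' t - 1) / (t : ℂ) =
      -(μ' t * (q ⬝ᵥ (complexify (A t) *ᵥ v' t))) / (q ⬝ᵥ v' t) := by
    filter_upwards [hlbad, htpos, hdot.eventually_ne hqv0] with t ht htp hne
    have htc : (t : ℂ) ≠ 0 := by exact_mod_cast htp.ne'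
    have h1 : complexify (W + t • A t) = complexify W + (t : ℂ) • complexify (A t) := by
      ext a b
      simp [complexify]
    have h2 : q ⬝ᵥ v' t = μ' t * (q ⬝ᵥ v' t + t * (q ⬝ᵥ (complexify (A t) *ᵥ v' t))) := by
      conv_lhs => rw [ht.2.2]
      rw [h1, add_mulVec, smul_mulVec, dotProduct_smul, dotProduct_add, dotProduct_smul,
        dotProduct_mulVec, hqW, smul_eq_mul, smul_eq_mul]
    rw [div_eq_div_iff htc hne]
    linear_combination -h2
  have hslope : Tendsto (fun t : ℝ => (μ' t - 1) / (t : ℂ)) l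
      (𝓝 ((-(p ⬝ᵥ (A₀ *ᵥ 1)) / (p ⬝ᵥ 1) : ℝ) : ℂ)) := by
    have h1 := (hμ.mul (tendsto_dotProduct q (tendsto_complexify_mulVec hAl hv))).neg.div
      hdot hqv0
    have h2 : -(μ * (q ⬝ᵥ (complexify A₀ *ᵥ v))) / (q ⬝ᵥ v) =
        ((-(p ⬝ᵥ (A₀ *ᵥ 1)) / (p ⬝ᵥ 1) : ℝ) : ℂ) := by
      have h3 : q ⬝ᵥ (complexify A₀ *ᵥ v) = v i * ((p ⬝ᵥ (A₀ *ᵥ 1) : ℝ) : ℂ) := by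
        rw [← hqA]
        conv_lhs => rw [hvi]
        rw [mulVec_smul, dotProduct_smul, smul_eq_mul]
      have hc : ((p ⬝ᵥ 1 : ℝ) : ℂ) ≠ 0 := by exact_mod_cast hp1.ne'
      have hi' : v i ≠ 0 := hi
      rw [hμone, h3, hqv, Complex.ofReal_div, Complex.ofReal_neg]
      field_simp
    rw [← h2]
    exact h1.congr' (hid.mono fun t ht => ht.symm)
  have hre := (Complex.continuous_re.tendsto _).comp hslope
  rw [Complex.ofReal_re] at hre
  -- The limiting slope is positive because `μ'` is a reciprocal eigenvalue. Hence `Re μ' > 1`,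
  -- against `‖μ'‖ ≤ 1`.
  have hev := hre.eventually_const_lt (div_pos (neg_pos.2 hneg) hp1)
  obtain ⟨t, ht, htp, hb⟩ := (hev.and (htpos.and hlbad)).exists
  have h4 : 0 < ((μ' t).re - 1) / t := by
    simpa [Complex.div_ofReal_re] using ht
  have h5 := (div_pos_iff_of_pos_right htp).1 h4
  linarith [Complex.re_le_norm (μ' t), hb.1]

/-! ### Expansions of `P` and `R` -/

lemma tendsto_inv_one_add_smul (B : Matrix (Fin n) (Fin n) ℝ) :
    Tendsto (fun t : ℝ => (1 + t • B)⁻¹) (𝓝[>] 0) (𝓝 1) := by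
  have hB : Continuous fun t : ℝ => 1 + t • B := by fun_prop
  have hc : ContinuousAt (fun t : ℝ => ((1 + t • B).det)⁻¹ • (1 + t • B).adjugate) 0 := by
    refine ContinuousAt.smul (hB.matrix_det.continuousAt.inv₀ ?_) hB.matrix_adjugate.continuousAt
    rw [zero_smul, add_zero, det_one]
    exact one_ne_zero
  have h1 := hc.tendsto.mono_left (nhdsWithin_le_nhds (s := Set.Ioi 0))
  simpa [Matrix.inv_def] using h1

lemma eventually_isUnit_one_add_smul (B : Matrix (Fin n) (Fin n) ℝ) :
    ∀ᶠ t in 𝓝[>] (0 : ℝ), IsUnit (1 + t • B) := by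
  have hc : Continuous fun t : ℝ => 1 + t • B := by fun_prop
  have h := (hc.matrix_det.tendsto 0).mono_left (nhdsWithin_le_nhds (s := Set.Ioi 0))
  rw [zero_smul, add_zero, det_one] at h
  refine (h.eventually_ne one_ne_zero).mono fun t ht => ?_
  exact (isUnit_iff_isUnit_det _).2 (isUnit_iff_ne_zero.2 ht)

lemma P_eq (W B : Matrix (Fin n) (Fin n) ℝ) (t : ℝ) : P W B t = W + t • -(W * B) := by
  rw [P, mul_sub, mul_one, mul_smul_comm, smul_neg, sub_eq_add_neg]

lemma R_eq (W B : Matrix (Fin n) (Fin n) ℝ) {t : ℝ} (ht : IsUnit (1 + t • B)) :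
    R W B t = W + t • -((1 + t • B)⁻¹ * B * ((2 : ℝ) • W - 1)) := by
  have h : (1 + t • B)⁻¹ = 1 - t • ((1 + t • B)⁻¹ * B) := by
    have := nonsing_inv_mul _ ((isUnit_iff_isUnit_det _).1 ht)
    rw [mul_add, mul_one, mul_smul_comm] at this
    exact eq_sub_of_add_eq this
  rw [R]
  conv_lhs => rw [h]
  rw [sub_mul, one_mul, smul_mul_assoc, smul_neg, two_smul]
  abel

end ImageOperators

open ImageOperators in
theorem mainTheorem6 {n : ℕ} (W B : Matrix (Fin n) (Fin n) ℝ)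
    (hWs : W ∈ Matrix.rowStochastic ℝ (Fin n)) (hWp : W.IsPrimitive)
    (hB : ∀ i j, 0 ≤ B i j) (hB0 : B ≠ 0) :
    ∃ T : ℝ, 0 < T ∧ ∀ t : ℝ, 0 < t → t < T →
      IsUnit (1 + t • B) ∧
      ImageOperators.SchurStable (ImageOperators.complexify (ImageOperators.P W B t)) ∧
      ImageOperators.SchurStable (ImageOperators.complexify (ImageOperators.R W B t)) := by
  obtain ⟨i, j, hij⟩ : ∃ i j, B i j ≠ 0 := by
    by_contra! h
    exact hB0 (Matrix.ext fun i j => h i j)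
  -- The index of a nonzero entry of `B` also shows `0 < n`.
  obtain ⟨p, hp, hpW⟩ := exists_pos_vecMul_eq i.pos hWs hWp
  have hW1 : W *ᵥ 1 = 1 := one_vecMul_of_mem_rowStochastic hWs
  have hpB : 0 < p ⬝ᵥ (B *ᵥ 1) := by
    have hrow : ∀ a, 0 ≤ (B *ᵥ 1) a := fun a => by
      change 0 ≤ ∑ b, B a b * 1
      exact Finset.sum_nonneg fun b _ => mul_nonneg (hB a b) zero_le_one
    refine Finset.sum_pos' (fun a _ => mul_nonneg (hp a).le (hrow a))
      ⟨i, mem_univ i, mul_pos (hp i) ?_⟩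
    exact Finset.sum_pos' (fun b _ => mul_nonneg (hB i b) zero_le_one)
      ⟨j, mem_univ j, by simpa using (hB i j).lt_of_ne' hij⟩
  have hPs : ∀ᶠ t in 𝓝[>] (0 : ℝ), SchurStable (complexify (P W B t)) := by
    simp only [P_eq]
    refine eventually_schurStable hWs hWp hp hpW tendsto_const_nhds ?_
    rw [neg_mulVec, dotProduct_neg, ← mulVec_mulVec, dotProduct_mulVec, hpW]
    exact neg_neg_of_pos hpB
  have hRs : ∀ᶠ t in 𝓝[>] (0 : ℝ), SchurStable (complexify (R W B t)) := by
    have hlim : Tendsto (fun t : ℝ => -((1 + t • B)⁻¹ * B * ((2 : ℝ) • W - 1))) (𝓝[>] 0)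
        (𝓝 (-(1 * B * ((2 : ℝ) • W - 1)))) :=
      (((tendsto_inv_one_add_smul B).mul_const B).mul_const _).neg
    -- Hence the factor `2W - I` drops out of `p A₀ 1`, leaving the same `-p B 1` as for `P`.
    have h2 : ((2 : ℝ) • W - 1) *ᵥ (1 : Fin n → ℝ) = 1 := by
      rw [sub_mulVec, smul_mulVec, hW1, one_mulVec, two_smul, add_sub_cancel_right]
    have hs := eventually_schurStable hWs hWp hp hpW hlim (by
      rw [neg_mulVec, dotProduct_neg, one_mul, ← mulVec_mulVec, h2]
      exact neg_neg_of_pos hpB)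
    filter_upwards [hs, eventually_isUnit_one_add_smul B] with t ht hu
    rwa [R_eq W B hu]
  have hall := (eventually_isUnit_one_add_smul B).and (hPs.and hRs)
  obtain ⟨T, hT, hsub⟩ := mem_nhdsGT_iff_exists_Ioo_subset.1 hall
  exact ⟨T, hT, fun t ht htT => hsub ⟨ht, htT⟩⟩
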